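/- **Conventions.** All transformations are invertible, with $T$ and $T^{-1}$ measurable. A transformation $T$ of a measure space $(X,\mathscr B,\mu)$ is *nonsingular* if, for every $A\in\mathscr B$, $\mu(T^{-1}A)=0$ if and only if $\mu(A)=0$. It *has no finite invariant measure* if there is no finite $T$-invariant measure on $\mathscr B$ that is equivalent to $\mu$ (has the same null sets as $\mu$). It is *conservative* if for every $A\in\mathscr B$ with $\mu(A)>0$ there is an integer $n\neq 0$ with $\mu(T^nA\cap A)>0$. *Rank-one skyscraper transformations* of $[0,\infty)$ with Lebesgue measure $\lambda$ are obtained as follows. A column is a finite sequence of disjoint intervals (levels) of equal length, each thought of as lying above the preceding one; its column map translates each level, except the top one, onto the level above it. Start with the column $C_0=\{[0,1)\}$. Given $C_n$, cut it into two subcolumns of equal width, put a finite number $s_n\ge 0$ of spacers on top of the right subcolumn and none on the left one, and stack the right subcolumn (with its spacers) on top of the left one to get $C_{n+1}$. The spacers are half-open intervals of the length of the new levels, laid consecutively to the right of the part of $[0,\infty)$ already used. The numbers $s_n$ are such that the columns fill up $[0,\infty)$. Then $S:[0,\infty)\to[0,\infty)$ is, up to a $\lambda$-null set, the pointwise limit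 of the column maps. **Theorem.** Let $\{T_i\}_{i\in\mathbb N}$ be a countable collection of nonsingular transformations of $\sigma$-finite measure spaces $(X_i,\mathscr B_i,\mu_i)$ (for instance nonatomic Lebesgue spaces), none of which has a finite invariant measure. Then there exists a single rank-one skyscraper transformation $S$ of $([0,\infty),\lambda)$ such that for every $i\in\mathbb N$ the product $T_i\times S$ is not conservative with respect to $\mu_i\times\lambda$. -/

import Mathlib

open MeasureTheory Filter

/-! ### Nonsingular and conservative transformations

Invertible measurable transformations of `X` are measurable equivalences `X ≃ᵐ X`. -/

/-- `T` is nonsingular: `T⁻¹ A` is null iff `A` is null. -/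
def IsNonsingular {X : Type*} [MeasurableSpace X] (T : X ≃ᵐ X) (μ : Measure X) : Prop :=
  ∀ A : Set X, MeasurableSet A → (μ (T ⁻¹' A) = 0 ↔ μ A = 0)

/-- There is a finite `T`-invariant measure with the same null sets as `μ`. -/
def HasFiniteInvariantMeasure {X : Type*} [MeasurableSpace X] (T : X ≃ᵐ X) (μ : Measure X) :
    Prop :=
  ∃ ν : Measure X, IsFiniteMeasure ν ∧ MeasurePreserving T ν ν ∧ μ ≪ ν ∧ ν ≪ μ

/-- The conservative sequence `{n ∈ ℤ : μ (Tⁿ A ∩ A) > 0}` of `A` under `T`. -/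
def conservativeSequence {X : Type*} [MeasurableSpace X] (T : X ≃ᵐ X) (μ : Measure X)
    (A : Set X) : Set ℤ :=
  {n : ℤ | 0 < μ ((((T.toEquiv : Equiv.Perm X) ^ n : Equiv.Perm X) '' A) ∩ A)}

/-- `T` is conservative: every set of positive measure returns to itself, with positive measure,
at some nonzero time. -/
def IsConservative {X : Type*} [MeasurableSpace X] (T : X ≃ᵐ X) (μ : Measure X) : Prop :=
  ∀ A : Set X, MeasurableSet A → 0 < μ A → ∃ n ∈ conservativeSequence T μ A, n ≠ 0

/-! ### Cutting and stacking -/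

/-- A column: a stack of intervals `[a, a + width)`, listed from bottom to top by their left
endpoints `a`. -/
structure StackColumn where
  width : ℝ
  levels : List ℝ

namespace StackColumn

/-- The number of levels. -/
def height (C : StackColumn) : ℕ := C.levels.length

/-- The total length of the levels. -/
noncomputable def mass (C : StackColumn) : ℝ := C.height * C.width

/-- Cut `C` into `r` subcolumns of equal width, put `s i` spacers on top of the `i`-th one
(counted from the left, starting with `0`), and stack each subcolumn on top of the one to its left.
The spacers are consecutive intervals, the first of which starts at the point `C.mass`: if the
levels of `C` partition `[0, C.mass)`, then those of the new column partition `[0, C'.mass)`. -/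
noncomputable def cutAndStack (C : StackColumn) (r : ℕ) (s : ℕ → ℕ) : StackColumn where
  width := C.width / r
  levels := (List.range r).flatMap fun i : ℕ =>
    C.levels.map (fun a => a + i * (C.width / r)) ++
      (List.range (s i)).map fun j =>
        C.mass + (((∑ l ∈ Finset.range i, s l) + j : ℕ) : ℝ) * (C.width / r)

/-- The column map of `C` is defined at `x` and sends it to `y`: the point `x` lies on a level that
is not the top one, and `y` is the point above it on the next level. -/
def MapsTo (C : StackColumn) (x y : ℝ) : Prop :=
  ∃ (k : ℕ) (hk : k + 1 < C.levels.length),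
    x ∈ Set.Ico C.levels[k] (C.levels[k] + C.width) ∧ y = x - C.levels[k] + C.levels[k + 1]

end StackColumn

/-- The parameters of a rank-one construction: the number `cuts n` of subcolumns into which the
`n`-th column is cut, and the number `spacers n i` of spacers on the `i`-th subcolumn (relevant for
`i < cuts n`). -/
structure RankOneData where
  cuts : ℕ → ℕ
  two_le_cuts : ∀ n, 2 ≤ cuts n
  spacers : ℕ → ℕ → ℕ

namespace RankOneData

/-- The columns `C₀, C₁, …`, starting with the single level `[0, 1)`. -/
noncomputable def column (D : RankOneData) : ℕ → StackColumn
  | 0 => ⟨1, [0]⟩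
  | n + 1 => (D.column n).cutAndStack (D.cuts n) (D.spacers n)

/-- The construction fills up all of `[0, ∞)`. -/
def FillsHalfLine (D : RankOneData) : Prop :=
  Tendsto (fun n => (D.column n).mass) atTop atTop

/-- Skyscraper constructions: every column is cut into two subcolumns, and spacers are added to the
right subcolumn only. -/
def IsSkyscraper (D : RankOneData) : Prop :=
  ∀ n, D.cuts n = 2 ∧ D.spacers n 0 = 0

end RankOneData

/-- The half-line `[0, ∞)`. -/
abbrev HalfLine : Type := Set.Ici (0 : ℝ)

/-- Lebesgue measure on `[0, ∞)`. -/
noncomputable def halfLineMeasure : Measure HalfLine :=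
  Measure.comap ((↑) : HalfLine → ℝ) volume

/-- `S` is the (infinite) rank-one transformation of `[0, ∞)` constructed from `D`: up to a null
set, it is the pointwise limit of the column maps. The column map of each column extends that of
the preceding one, so the limit means that the column maps at `x` are eventually defined and equal
to `S x`. -/
def IsRankOneTransformation (D : RankOneData) (S : HalfLine ≃ᵐ HalfLine) : Prop :=
  D.FillsHalfLine ∧
    ∀ᵐ x : HalfLine ∂halfLineMeasure, ∀ᶠ n in atTop, (D.column n).MapsTo (x : ℝ) (S x : ℝ)

/-- `S` is a rank-one skyscraper transformation of `[0, ∞)`. -/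
def IsSkyscraperTransformation (S : HalfLine ≃ᵐ HalfLine) : Prop :=
  ∃ D : RankOneData, D.IsSkyscraper ∧ IsRankOneTransformation D S

/-! The product `T i × S` fails to be conservative as soon as some `W` and `B` of positive measure
have no common nonzero return time: then `W ×ˢ B` never returns. The heights of the columns of a
skyscraper can be prescribed, and they nearly determine its return times: a point of the base of
column `N + 1` can return to that base only at times within `2 * h k` of `h (k + 1)`, for some `k ≥
N` (`IsAbove.exists_height_near`). So it suffices to choose heights whose neighbourhoods consist of
times that are bad for the `T i`.

Such times come from the absence of a finite invariant measure. After replacing `μ` by an equivalent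
finite measure, the Banach limit of `μ (T⁻ⁿ A)` is a finitely additive, `T`-invariant set function
of `A`. The measure obtained from it by Carathéodory's construction is finite, invariant and
absolutely continuous with respect to `μ`. It cannot be equivalent to `μ`, and this yields a set `A`
of positive measure whose Banach limit is zero (`exists_meanDensity_eq_zero`). Hence `μ (T⁻ʲ A)` is
as small as desired along arbitrarily long windows of times `j`, simultaneously for finitely many
transformations.

The heights are picked recursively at the centres of such windows, the `i`-th transformation being
controlled from stage `i` on. Removing from `A i` the points that enter `A i` at a controlled time
costs less than its whole measure and leaves the set `W` (`exists_heights_forall_exists_avoiding`).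
It is paired with the base of column `i + 1`. -/

/-! ### A Banach limit -/

/-- The Cesàro averages of a sequence. -/
noncomputable def cesaro (f : ℕ → ENNReal) (n : ℕ) : ENNReal :=
  (∑ j ∈ Finset.range n, f j) / n

/-- The limit of the Cesàro averages along a fixed free ultrafilter. -/
noncomputable def banachLim (f : ℕ → ENNReal) : ENNReal :=
  limUnder (hyperfilter ℕ : Filter ℕ) (cesaro f)

/-- By compactness of `ENNReal`, every ultrafilter on it converges. -/
lemma tendsto_banachLim (f : ℕ → ENNReal) :
    Tendsto (cesaro f) (hyperfilter ℕ) (nhds (banachLim f)) := by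
  have h := ((hyperfilter ℕ).map (cesaro f)).le_nhds_lim
  exact h

lemma banachLim_add (f g : ℕ → ENNReal) :
    banachLim (fun n => f n + g n) = banachLim f + banachLim g := by
  refine tendsto_nhds_unique (tendsto_banachLim _) ?_
  refine ((tendsto_banachLim f).add (tendsto_banachLim g)).congr fun n => ?_
  simp only [cesaro, Finset.sum_add_distrib, ENNReal.add_div]

lemma banachLim_mono {f g : ℕ → ENNReal} (h : ∀ n, f n ≤ g n) : banachLim f ≤ banachLim g :=
  le_of_tendsto_of_tendsto' (tendsto_banachLim f) (tendsto_banachLim g) fun _ =>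
    ENNReal.div_le_div_right (Finset.sum_le_sum fun j _ => h j) _

lemma banachLim_const (c : ENNReal) : banachLim (fun _ => c) = c := by
  refine tendsto_nhds_unique (tendsto_banachLim _) ?_
  refine Tendsto.mono_left ?_ (Nat.hyperfilter_le_atTop)
  refine tendsto_const_nhds.congr' ?_
  filter_upwards [eventually_gt_atTop 0] with n hn
  have h0 : (n : ENNReal) ≠ 0 := by exact_mod_cast hn.ne'
  simp only [cesaro, Finset.sum_const, Finset.card_range, nsmul_eq_mul]
  rw [mul_comm, ENNReal.mul_div_cancel_right h0 (ENNReal.natCast_ne_top n)]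

/-- The two sums of `n` terms differ only in the end terms `f 0` and `f n`, so the averages differ
by at most `C / n`. -/
lemma banachLim_succ {f : ℕ → ENNReal} {C : ENNReal} (hC : C ≠ ⊤) (hf : ∀ n, f n ≤ C) :
    banachLim (fun n => f (n + 1)) = banachLim f := by
  have hlim : Tendsto (fun n : ℕ => C / n) (hyperfilter ℕ) (nhds 0) :=
    Tendsto.mono_left (by simpa [div_eq_mul_inv] using
      ENNReal.Tendsto.const_mul ENNReal.tendsto_inv_nat_nhds_zero (Or.inr hC))
      Nat.hyperfilter_le_atTop
  have hsum : ∀ n, (∑ j ∈ Finset.range n, f (j + 1)) + f 0 = (∑ j ∈ Finset.range n, f j) + f n :=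
    fun n => by rw [← Finset.sum_range_succ', Finset.sum_range_succ]
  apply le_antisymm
  · refine le_of_tendsto_of_tendsto' (tendsto_banachLim _)
      (by simpa using (tendsto_banachLim f).add hlim) fun n => ?_
    simp only [cesaro]
    rw [← ENNReal.add_div]
    refine ENNReal.div_le_div_right (le_self_add.trans ((hsum n).le.trans ?_)) _
    gcongr
    exact hf n
  · refine le_of_tendsto_of_tendsto' (tendsto_banachLim _)
      (by simpa using (tendsto_banachLim (fun n => f (n + 1))).add hlim) fun n => ?_
    simp only [cesaro]
    rw [← ENNReal.add_div]
    refine ENNReal.div_le_div_right (le_self_add.trans ((hsum n).ge.trans ?_)) _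
    gcongr
    exact hf 0

lemma banachLim_add_nat {f : ℕ → ENNReal} {C : ENNReal} (hC : C ≠ ⊤) (hf : ∀ n, f n ≤ C) (m : ℕ) :
    banachLim (fun n => f (n + m)) = banachLim f := by
  induction m with
  | zero => rfl
  | succ m ih =>
    rw [← ih, ← banachLim_succ hC (fun n => hf (n + m))]
    congr 1; ext n; congr 1; ring

lemma banachLim_sum {ι : Type*} (s : Finset ι) (f : ι → ℕ → ENNReal) :
    banachLim (fun n => ∑ i ∈ s, f i n) = ∑ i ∈ s, banachLim (f i) := by
  classical
  induction s using Finset.induction_on with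
  | empty => simpa using banachLim_const 0
  | insert i s hi ih => simp only [Finset.sum_insert hi, banachLim_add, ih]

lemma exists_lt_of_banachLim_eq_zero {f : ℕ → ENNReal} (h : banachLim f = 0)
    {ε : ENNReal} (hε : 0 < ε) : ∃ n, f n < ε := by
  by_contra! hcon
  have := banachLim_mono (f := fun _ => ε) (g := f) hcon
  rw [banachLim_const, h] at this
  exact hε.not_ge this

/-! ### The asymptotic density of a set under a nonsingular transformation -/

section meanDensity

variable {X : Type*} [MeasurableSpace X] (T : X ≃ᵐ X) (μ : Measure X)

/-- The mean of the measures of the preimages of `A`. -/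
noncomputable def meanDensity (A : Set X) : ENNReal :=
  banachLim fun n => μ ((T^[n]) ⁻¹' A)

variable {T μ}

lemma meanDensity_mono {A B : Set X} (h : A ⊆ B) : meanDensity T μ A ≤ meanDensity T μ B :=
  banachLim_mono fun _ => measure_mono (Set.preimage_mono h)

lemma meanDensity_empty : meanDensity T μ ∅ = 0 := by
  simp [meanDensity, banachLim_const]

lemma meanDensity_biUnion_le (s : Finset ℕ) (A : ℕ → Set X) :
    meanDensity T μ (⋃ k ∈ s, A k) ≤ ∑ k ∈ s, meanDensity T μ (A k) := by
  simp only [meanDensity]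
  rw [← banachLim_sum]
  refine banachLim_mono fun n => ?_
  rw [Set.preimage_iUnion₂]
  exact measure_biUnion_finset_le _ _

lemma meanDensity_inter_add_diff (E : Set X) {A : Set X} (hA : MeasurableSet A) :
    meanDensity T μ (E ∩ A) + meanDensity T μ (E \ A) = meanDensity T μ E := by
  simp only [meanDensity]
  rw [← banachLim_add]
  congr 1; ext n
  rw [Set.preimage_inter, Set.preimage_sdiff]
  exact measure_inter_add_sdiff _ ((T.measurable.iterate n) hA)

lemma meanDensity_preimage [IsFiniteMeasure μ] (A : Set X) :
    meanDensity T μ (T ⁻¹' A) = meanDensity T μ A := by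
  have := banachLim_succ (f := fun n => μ ((T^[n]) ⁻¹' A)) (measure_ne_top μ Set.univ)
    (fun n => measure_mono (Set.subset_univ _))
  rw [meanDensity, meanDensity, ← this]
  congr 1; ext n
  rw [← Set.preimage_comp, ← Function.iterate_succ']

lemma meanDensity_le (A : Set X) : meanDensity T μ A ≤ μ Set.univ :=
  (banachLim_mono fun _ => measure_mono (Set.subset_univ _)).trans (banachLim_const _).le

lemma IsNonsingular.iterate (hT : IsNonsingular T μ) (n : ℕ) {A : Set X} (hA : MeasurableSet A) :
    μ ((T^[n]) ⁻¹' A) = 0 ↔ μ A = 0 := by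
  induction n generalizing A with
  | zero => simp
  | succ n ih =>
    rw [Function.iterate_succ', Set.preimage_comp, ih (T.measurable hA), hT A hA]

lemma meanDensity_eq_zero (hT : IsNonsingular T μ) {A : Set X} (hA : MeasurableSet A)
    (h : μ A = 0) : meanDensity T μ A = 0 := by
  simp only [meanDensity, (hT.iterate _ hA).2 h, banachLim_const]

/-- A single measurable hull serves the countably many measures `μ.map (T^[n])`. This makes the
arbitrary covers in `OuterMeasure.ofFunction` measurable at no cost. -/
lemma exists_measurable_superset_meanDensity_eq (A : Set X) :
    ∃ B, A ⊆ B ∧ MeasurableSet B ∧ meanDensity T μ B = meanDensity T μ A := by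
  obtain ⟨B, hAB, hB, h⟩ := exists_measurable_superset_forall_eq
    (fun n : ℕ => μ.map (T^[n])) A
  have hemb : ∀ n : ℕ, MeasurableEmbedding (T^[n]) := fun n => by
    induction n with
    | zero => exact MeasurableEmbedding.id
    | succ n ih => exact ih.comp T.measurableEmbedding
  refine ⟨B, hAB, hB, ?_⟩
  simp only [meanDensity]
  congr 1; ext n
  simpa only [(hemb n).map_apply] using h n

variable (T μ) in
/-- The outer measure generated by `meanDensity`. -/
noncomputable def meanOuterMeasure : OuterMeasure X :=
  OuterMeasure.ofFunction (meanDensity T μ) meanDensity_empty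

lemma meanOuterMeasure_le (A : Set X) : meanOuterMeasure T μ A ≤ meanDensity T μ A :=
  OuterMeasure.ofFunction_le A

/-- Carathéodory's criterion need only be checked on the generating function, where it is the
additivity of `meanDensity`. -/
lemma le_caratheodory_meanOuterMeasure :
    (inferInstance : MeasurableSpace X) ≤ (meanOuterMeasure T μ).caratheodory := by
  intro A hA
  refine OuterMeasure.ofFunction_caratheodory fun E => ?_
  rw [meanDensity_inter_add_diff E hA]

variable (T μ) in
/-- The countably additive part of `meanDensity`. -/
noncomputable def meanMeasure : Measure X :=
  (meanOuterMeasure T μ).toMeasure le_caratheodory_meanOuterMeasure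

lemma meanMeasure_le {A : Set X} (hA : MeasurableSet A) :
    meanMeasure T μ A ≤ meanDensity T μ A := by
  rw [meanMeasure, toMeasure_apply _ _ hA]
  exact meanOuterMeasure_le A

lemma meanOuterMeasure_preimage_le [IsFiniteMeasure μ] (A : Set X) :
    meanOuterMeasure T μ (T ⁻¹' A) ≤ meanOuterMeasure T μ A := by
  rw [meanOuterMeasure, OuterMeasure.ofFunction_apply, OuterMeasure.ofFunction_apply]
  refine le_iInf₂ fun t ht => ?_
  refine (iInf₂_le (fun n => T ⁻¹' t n) ?_).trans ?_
  · rw [← Set.preimage_iUnion]; exact Set.preimage_mono ht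
  · simp only [meanDensity_preimage]; exact le_rfl

lemma le_meanOuterMeasure_preimage [IsFiniteMeasure μ] (A : Set X) :
    meanOuterMeasure T μ A ≤ meanOuterMeasure T μ (T ⁻¹' A) := by
  rw [meanOuterMeasure, OuterMeasure.ofFunction_apply, OuterMeasure.ofFunction_apply]
  refine le_iInf₂ fun t ht => ?_
  refine (iInf₂_le (fun n => T.symm ⁻¹' t n) ?_).trans ?_
  · intro x hx
    obtain ⟨n, hn⟩ := Set.mem_iUnion.1 (ht (show T.symm x ∈ T ⁻¹' A by simpa using hx))
    exact Set.mem_iUnion.2 ⟨n, hn⟩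
  · refine (tsum_congr fun n => ?_).le
    rw [← meanDensity_preimage, ← Set.preimage_comp]
    simp

lemma measurePreserving_meanMeasure [IsFiniteMeasure μ] :
    MeasurePreserving T (meanMeasure T μ) (meanMeasure T μ) := by
  refine ⟨T.measurable, ?_⟩
  ext A hA
  rw [Measure.map_apply T.measurable hA, meanMeasure, toMeasure_apply _ _ hA,
    toMeasure_apply _ _ (T.measurable hA)]
  exact le_antisymm (meanOuterMeasure_preimage_le A) (le_meanOuterMeasure_preimage A)

lemma isFiniteMeasure_meanMeasure [IsFiniteMeasure μ] : IsFiniteMeasure (meanMeasure T μ) :=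
  ⟨(meanMeasure_le MeasurableSet.univ).trans_lt
    ((meanDensity_le _).trans_lt (measure_lt_top μ _))⟩

lemma meanMeasure_absolutelyContinuous (hT : IsNonsingular T μ) : meanMeasure T μ ≪ μ :=
  Measure.AbsolutelyContinuous.mk fun _ hA h =>
    le_antisymm ((meanMeasure_le hA).trans (meanDensity_eq_zero hT hA h).le) zero_le

/-- A set that is null for `meanMeasure` is, up to small measure, of small `meanDensity`. -/
lemma exists_finite_cover_of_meanMeasure_eq_zero [IsFiniteMeasure μ] {A : Set X}
    (hA : MeasurableSet A) (h : meanMeasure T μ A = 0) {ε δ : ENNReal} (hε : 0 < ε) (hδ : 0 < δ) :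
    ∃ B, MeasurableSet B ∧ meanDensity T μ B < ε ∧ μ (A \ B) < δ := by
  rw [meanMeasure, toMeasure_apply _ _ hA, meanOuterMeasure, OuterMeasure.ofFunction_apply] at h
  have h' := h.trans_lt hε
  simp only [iInf_lt_iff] at h'
  obtain ⟨t, ht, hlt⟩ := h'
  choose u htu hu hut using fun n =>
    exists_measurable_superset_meanDensity_eq (T := T) (μ := μ) (t n)
  -- Since `meanDensity` is only finitely subadditive, the countable cover is truncated; continuity
  -- from above of `μ` bounds what is lost.
  have hanti : Antitone fun K : ℕ => A \ ⋃ k ∈ Finset.range K, u k := by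
    intro K L hKL
    refine Set.sdiff_subset_sdiff_right (Set.biUnion_subset_biUnion_left ?_)
    intro k hk; exact Finset.range_subset_range.2 hKL hk
  have hmeas : ∀ K : ℕ, MeasurableSet (⋃ k ∈ Finset.range K, u k) := fun K =>
    Finset.measurableSet_biUnion _ fun k _ => hu k
  have hlim := tendsto_measure_iInter_atTop (μ := μ)
    (fun K => (hA.diff (hmeas K)).nullMeasurableSet) hanti ⟨0, measure_ne_top _ _⟩
  have hempty : ⋂ K : ℕ, A \ ⋃ k ∈ Finset.range K, u k = ∅ := by
    ext x
    simp only [Set.mem_iInter, Set.mem_sdiff, Set.mem_empty_iff_false, iff_false]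
    intro hx
    obtain ⟨k, hk⟩ := Set.mem_iUnion.1 (ht (hx 0).1)
    exact (hx (k + 1)).2 (Set.mem_biUnion (Finset.mem_coe.2 (Finset.self_mem_range_succ k))
      (htu k hk))
  rw [hempty, measure_empty] at hlim
  obtain ⟨K, hK⟩ := (hlim.eventually (gt_mem_nhds hδ)).exists
  refine ⟨_, hmeas K, ?_, hK⟩
  calc _ ≤ ∑ k ∈ Finset.range K, meanDensity T μ (u k) := meanDensity_biUnion_le _ _
    _ = ∑ k ∈ Finset.range K, meanDensity T μ (t k) := Finset.sum_congr rfl fun k _ => hut k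
    _ ≤ ∑' k, meanDensity T μ (t k) := ENNReal.sum_le_tsum _
    _ < ε := hlt

/-- Intersect sets of `meanDensity` tending to zero, each missing so little of `A` that the total
loss is less than `μ A`. -/
lemma exists_subset_meanDensity_eq_zero [IsFiniteMeasure μ] {A : Set X} (hA : MeasurableSet A)
    (h : meanMeasure T μ A = 0) (hpos : μ A ≠ 0) :
    ∃ B, MeasurableSet B ∧ μ B ≠ 0 ∧ meanDensity T μ B = 0 := by
  obtain ⟨δ, hδ, hsum⟩ := ENNReal.exists_pos_sum_of_countable' hpos ℕ
  choose B hB hBε hBδ using fun n : ℕ => exists_finite_cover_of_meanMeasure_eq_zero hA h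
    (ε := ((n : ENNReal) + 1)⁻¹) (δ := δ n) (by simp) (hδ n)
  refine ⟨A ∩ ⋂ n, B n, hA.inter (MeasurableSet.iInter hB), fun h0 => ?_, ?_⟩
  · have hcov : A ⊆ (A ∩ ⋂ n, B n) ∪ ⋃ n, A \ B n := by
      intro x hx
      by_cases hxB : x ∈ ⋂ n, B n
      · exact Or.inl ⟨hx, hxB⟩
      · obtain ⟨n, hn⟩ := not_forall.1 (fun h => hxB (Set.mem_iInter.2 h))
        exact Or.inr (Set.mem_iUnion.2 ⟨n, hx, hn⟩)
    refine (lt_irrefl (μ A)) ?_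
    calc μ A ≤ μ (A ∩ ⋂ n, B n) + μ (⋃ n, A \ B n) := (measure_mono hcov).trans (measure_union_le _ _)
      _ ≤ ∑' n, μ (A \ B n) := by rw [h0, zero_add]; exact measure_iUnion_le _
      _ ≤ ∑' n, δ n := ENNReal.tsum_le_tsum fun n => (hBδ n).le
      _ < μ A := hsum
  · have hle : ∀ n : ℕ, meanDensity T μ (A ∩ ⋂ n, B n) ≤ ((n : ENNReal) + 1)⁻¹ := fun n =>
      (meanDensity_mono (Set.inter_subset_right.trans (Set.iInter_subset _ n))).trans (hBε n).le
    refine le_antisymm (ge_of_tendsto' (?_ : Tendsto _ atTop _) hle) zero_le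
    have := (tendsto_add_atTop_iff_nat (f := fun n : ℕ => ((n : ENNReal))⁻¹) 1).2
      ENNReal.tendsto_inv_nat_nhds_zero
    simpa using this

/-- If there is no equivalent finite invariant measure, then some set of positive measure has
`meanDensity` zero. -/
lemma exists_meanDensity_eq_zero [IsFiniteMeasure μ] (hT : IsNonsingular T μ)
    (hfin : ¬ HasFiniteInvariantMeasure T μ) :
    ∃ A, MeasurableSet A ∧ μ A ≠ 0 ∧ meanDensity T μ A = 0 := by
  by_contra! hcon
  refine hfin ⟨meanMeasure T μ, isFiniteMeasure_meanMeasure, measurePreserving_meanMeasure,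
    Measure.AbsolutelyContinuous.mk fun A hA h => ?_, meanMeasure_absolutelyContinuous hT⟩
  by_contra hpos
  obtain ⟨B, hB, hB0, hB1⟩ := exists_subset_meanDensity_eq_zero hA h hpos
  exact hcon B hB hB0 hB1

end meanDensity

/-! ### Common times of small return, and sets that avoid them -/

section times

variable {X : ℕ → Type*} [∀ i, MeasurableSpace (X i)] {μ : ∀ i, Measure (X i)}
  [∀ i, IsFiniteMeasure (μ i)] {T : ∀ i, X i ≃ᵐ X i} {A : ∀ i, Set (X i)}

/-- Finitely many sets of `meanDensity` zero have simultaneously small preimages along a long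
window of times. -/
lemma exists_window_measure_preimage_le (hA : ∀ i, meanDensity (T i) (μ i) (A i) = 0)
    (K H N : ℕ) {ε : ℕ → ENNReal} (hε : ∀ i, 0 < ε i) :
    ∃ n, N ≤ n ∧ ∀ i ≤ K, ∀ j, n ≤ j + 2 * H → j ≤ n + 2 * H →
      μ i (((T i)^[j]) ⁻¹' A i) ≤ ε i := by
  -- Adding up all transformations and all times of the window gives one sequence with Banach limit
  -- zero, so a single small term controls everything.
  have h0 : banachLim (fun m => ∑ i ∈ Finset.range (K + 1), ∑ r ∈ Finset.range (4 * H + 1),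
      μ i (((T i)^[m + (N + r)]) ⁻¹' A i)) = 0 := by
    rw [banachLim_sum]
    refine Finset.sum_eq_zero fun i _ => ?_
    rw [banachLim_sum]
    refine Finset.sum_eq_zero fun r _ => ?_
    rw [banachLim_add_nat (f := fun m => μ i (((T i)^[m]) ⁻¹' A i))
      (measure_ne_top (μ i) Set.univ) fun n => measure_mono (Set.subset_univ _)]
    exact hA i
  obtain ⟨m, hm⟩ := exists_lt_of_banachLim_eq_zero h0
    (ε := (Finset.range (K + 1)).inf ε) ((Finset.lt_inf_iff (by simp)).2 fun i _ => hε i)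
  -- The centre of the window `[m + N, m + N + 4 * H]`.
  refine ⟨m + N + 2 * H, by omega, fun i hi j hj1 hj2 => ?_⟩
  have hiK : i ∈ Finset.range (K + 1) := Finset.mem_range.2 (by omega)
  obtain ⟨r, rfl⟩ : ∃ r, j = m + (N + r) := ⟨j - m - N, by omega⟩
  have hr : r ∈ Finset.range (4 * H + 1) := Finset.mem_range.2 (by omega)
  calc _ ≤ ∑ r ∈ Finset.range (4 * H + 1), μ i (((T i)^[m + (N + r)]) ⁻¹' A i) :=
        Finset.single_le_sum (f := fun r => μ i (((T i)^[m + (N + r)]) ⁻¹' A i))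
          (fun _ _ => zero_le) hr
    _ ≤ _ := Finset.single_le_sum (f := fun i => ∑ r ∈ Finset.range (4 * H + 1),
          μ i (((T i)^[m + (N + r)]) ⁻¹' A i)) (fun _ _ => zero_le) hiK
    _ ≤ (Finset.range (K + 1)).inf ε := hm.le
    _ ≤ ε i := Finset.inf_le hiK

lemma exists_heights_measure_preimage_le (hA : ∀ i, meanDensity (T i) (μ i) (A i) = 0)
    {ε : ℕ → ℕ → ℕ → ENNReal} (hε : ∀ i k H, 0 < ε i k H) :
    ∃ h : ℕ → ℕ, h 0 = 1 ∧ (∀ k, 4 * h k ≤ h (k + 1)) ∧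
      ∀ i k, i ≤ k → ∀ j, h (k + 1) ≤ j + 2 * h k → j ≤ h (k + 1) + 2 * h k →
        μ i (((T i)^[j]) ⁻¹' A i) ≤ ε i k (h k) := by
  choose n hn1 hn2 using fun k H : ℕ => exists_window_measure_preimage_le hA k H (4 * H)
    (fun i => hε i k H)
  exact ⟨fun k => Nat.rec 1 (fun k H => n k H) k, rfl, fun k => hn1 k _,
    fun i k hik j hj1 hj2 => hn2 k _ i hik j hj1 hj2⟩

/-- There are rapidly increasing heights `h`, and sets of positive measure none of whose points
return at a time close to one of the later heights. -/
lemma exists_heights_forall_exists_avoiding (hA : ∀ i, meanDensity (T i) (μ i) (A i) = 0)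
    (hAm : ∀ i, MeasurableSet (A i)) (hpos : ∀ i, μ i (A i) ≠ 0) :
    ∃ h : ℕ → ℕ, h 0 = 1 ∧ (∀ k, 4 * h k ≤ h (k + 1)) ∧
      ∀ i, ∃ W, MeasurableSet W ∧ μ i W ≠ 0 ∧ ∀ x ∈ W, ∀ k, i ≤ k →
        ∀ j, h (k + 1) ≤ j + 2 * h k → j ≤ h (k + 1) + 2 * h k → (T i)^[j] x ∉ W := by
  choose δ hδ hsum using fun i => ENNReal.exists_pos_sum_of_countable' (hpos i) ℕ
  obtain ⟨h, h0, h4, hle⟩ := exists_heights_measure_preimage_le hA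
    -- The tolerance depends on the height `H` already reached: the `4 * H + 1` times around the
    -- next height then cost at most `δ i k` altogether.
    (ε := fun i k H => δ i k / (4 * H + 1 : ℕ))
    (fun i k H => ENNReal.div_pos (hδ i k).ne' (ENNReal.natCast_ne_top _))
  refine ⟨h, h0, h4, fun i => ?_⟩
  set J : ℕ → Finset ℕ := fun k =>
    if i ≤ k then Finset.Icc (h (k + 1) - 2 * h k) (h (k + 1) + 2 * h k) else ∅ with hJ
  set U : Set (X i) := ⋃ k, ⋃ j ∈ J k, ((T i)^[j]) ⁻¹' A i with hU
  have hUm : MeasurableSet U := MeasurableSet.iUnion fun k =>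
    Finset.measurableSet_biUnion _ fun j _ => ((T i).measurable.iterate j) (hAm i)
  have hUlt : μ i U < μ i (A i) := by
    refine lt_of_le_of_lt ((measure_iUnion_le _).trans (ENNReal.tsum_le_tsum fun k => ?_)) (hsum i)
    refine (measure_biUnion_finset_le _ _).trans ?_
    by_cases hik : i ≤ k
    · simp only [hJ, if_pos hik]
      refine (Finset.sum_le_card_nsmul _ _ (δ i k / (4 * h k + 1 : ℕ)) fun j hj => ?_).trans ?_
      · rw [Finset.mem_Icc] at hj
        exact hle i k hik j (by omega) hj.2
      · have hc : (Finset.Icc (h (k + 1) - 2 * h k) (h (k + 1) + 2 * h k)).card = 4 * h k + 1 := by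
          have := h4 k
          rw [Nat.card_Icc]; omega
        rw [hc, nsmul_eq_mul]
        exact ENNReal.mul_div_le
    · simp [hJ, hik]
  refine ⟨A i \ U, (hAm i).diff hUm, fun hz => ?_, fun x hx k hik j hj1 hj2 hjx => ?_⟩
  · refine hUlt.not_ge ((measure_le_inter_add_sdiff (μ i) (A i) U).trans ?_)
    rw [hz, add_zero]
    exact measure_mono Set.inter_subset_right
  · refine hx.2 (Set.mem_iUnion.2 ⟨k, Set.mem_biUnion (x := j) ?_ hjx.1⟩)
    simp only [hJ, if_pos hik, Finset.coe_Icc, Set.mem_Icc]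
    omega

end times

/-- Nonsingular transformations of σ-finite spaces without equivalent finite invariant measures
have sets of positive measure that do not return at times close to common heights. -/
lemma exists_heights_avoiding_of_not_hasFiniteInvariantMeasure {X : ℕ → Type*}
    [∀ i, MeasurableSpace (X i)] (μ : ∀ i, Measure (X i)) [∀ i, SigmaFinite (μ i)]
    (T : ∀ i, X i ≃ᵐ X i) (hT : ∀ i, IsNonsingular (T i) (μ i))
    (hfin : ∀ i, ¬ HasFiniteInvariantMeasure (T i) (μ i)) :
    ∃ h : ℕ → ℕ, h 0 = 1 ∧ (∀ k, 4 * h k ≤ h (k + 1)) ∧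
      ∀ i, ∃ W, MeasurableSet W ∧ μ i W ≠ 0 ∧ ∀ x ∈ W, ∀ k, i ≤ k →
        ∀ j, h (k + 1) ≤ j + 2 * h k → j ≤ h (k + 1) + 2 * h k → (T i)^[j] x ∉ W := by
  -- Hypotheses and conclusion depend only on the null sets, which `toFinite` preserves.
  have hT' : ∀ i, IsNonsingular (T i) (μ i).toFinite := fun i A hA => by
    rw [toFinite_apply_eq_zero_iff, toFinite_apply_eq_zero_iff]; exact hT i A hA
  have hfin' : ∀ i, ¬ HasFiniteInvariantMeasure (T i) (μ i).toFinite := by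
    rintro i ⟨ν, h1, h2, h3, h4⟩
    exact hfin i ⟨ν, h1, h2, (absolutelyContinuous_toFinite _).trans h3,
      h4.trans (toFinite_absolutelyContinuous _)⟩
  choose A hA hA0 hA1 using fun i => exists_meanDensity_eq_zero (hT' i) (hfin' i)
  obtain ⟨h, h0, h4, hW⟩ := exists_heights_forall_exists_avoiding hA1 hA hA0
  refine ⟨h, h0, h4, fun i => ?_⟩
  obtain ⟨W, h1, h2, h3⟩ := hW i
  exact ⟨W, h1, fun h => h2 (toFinite_apply_eq_zero_iff.2 h), h3⟩

/-! ### Skyscraper columns with prescribed heights -/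

/-- The skyscraper construction whose `n`-th column has height `h n`. -/
def skyscraperData (h : ℕ → ℕ) : RankOneData where
  cuts _ := 2
  two_le_cuts _ := le_rfl
  spacers n i := if i = 0 then 0 else h (n + 1) - 2 * h n

lemma isSkyscraper_skyscraperData (h : ℕ → ℕ) : (skyscraperData h).IsSkyscraper :=
  fun _ => ⟨rfl, rfl⟩

/-- The common length of the levels of the `n`-th column. -/
noncomputable def levelWidth (n : ℕ) : ℝ := (1 / 2) ^ n

lemma levelWidth_pos (n : ℕ) : 0 < levelWidth n := by unfold levelWidth; positivity

lemma levelWidth_eq_add (n : ℕ) : levelWidth n = levelWidth (n + 1) + levelWidth (n + 1) := by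
  unfold levelWidth; ring

lemma levelWidth_zero : levelWidth 0 = 1 := by simp [levelWidth]

lemma antitone_levelWidth : Antitone levelWidth :=
  antitone_nat_of_succ_le fun n => by
    have := levelWidth_pos (n + 1); have := levelWidth_eq_add n; linarith

/-- The left endpoint of the `k`-th level of the `n`-th column. -/
noncomputable def levelStart (h : ℕ → ℕ) : ℕ → ℕ → ℝ
  | 0, _ => 0
  | n + 1, k =>
    if k < h n then levelStart h n k
    else if k < 2 * h n then levelStart h n (k - h n) + levelWidth (n + 1)
    else h n * levelWidth n + ((k - 2 * h n : ℕ) : ℝ) * levelWidth (n + 1)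

/-- Rapidly increasing column heights, starting with `1`. -/
structure IsHeightSequence (h : ℕ → ℕ) : Prop where
  zero : h 0 = 1
  four_mul_le : ∀ k, 4 * h k ≤ h (k + 1)

namespace IsHeightSequence

variable {h : ℕ → ℕ}

lemma pos (hh : IsHeightSequence h) (n : ℕ) : 0 < h n := by
  induction n with
  | zero => simp [hh.zero]
  | succ n ih => have := hh.four_mul_le n; omega

lemma column_eq (hh : IsHeightSequence h) (n : ℕ) :
    (skyscraperData h).column n = ⟨levelWidth n, (List.range (h n)).map (levelStart h n)⟩ := by
  induction n with
  | zero => simp [RankOneData.column, levelWidth, hh.zero, levelStart]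
  | succ n ih =>
    have h4 := hh.four_mul_le n
    have hw : levelWidth n / 2 = levelWidth (n + 1) := by rw [levelWidth_eq_add n]; ring
    rw [RankOneData.column, ih]
    simp only [StackColumn.cutAndStack, StackColumn.mass, StackColumn.height, skyscraperData,
      Nat.cast_ofNat, hw, List.length_map, List.length_range]
    congr 1
    have hr : h (n + 1) = h n + (h n + (h (n + 1) - 2 * h n)) := by omega
    conv_rhs => rw [hr, List.range_add, List.range_add]
    simp only [List.range_succ, List.range_zero, List.nil_append, List.flatMap_cons,
      List.flatMap_append, List.flatMap_nil, List.append_nil, List.map_append, List.map_map]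
    simp only [Nat.cast_zero, zero_mul, add_zero, if_true, List.range_zero, List.map_nil,
      List.append_nil, one_ne_zero, if_false, Finset.sum_range_one, zero_add, Nat.cast_one, one_mul]
    congr 1
    · refine List.map_congr_left fun k hk => ?_
      simp [levelStart, List.mem_range.1 hk]
    congr 1
    · refine List.map_congr_left fun k hk => ?_
      have := List.mem_range.1 hk
      simp [levelStart, show h n + k < 2 * h n by omega]
    · refine List.map_congr_left fun k hk => ?_
      simp [levelStart, show ¬ h n + h n + k < h n by omega,
        show ¬ h n + h n + k < 2 * h n by omega, show h n + h n + k - 2 * h n = k by omega]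

/-- The heights at least quadruple while the width halves, so the mass at least doubles. -/
lemma tendsto_mass (hh : IsHeightSequence h) :
    Tendsto (fun n => (h n : ℝ) * levelWidth n) atTop atTop := by
  have hle : ∀ n, (2 : ℝ) ^ n ≤ h n * levelWidth n := fun n => by
    induction n with
    | zero => simp [hh.zero, levelWidth]
    | succ n ih =>
      have h4 : (4 : ℝ) * h n ≤ h (n + 1) := by exact_mod_cast hh.four_mul_le n
      have := levelWidth_eq_add n
      have := levelWidth_pos (n + 1)
      calc (2 : ℝ) ^ (n + 1) = 2 * 2 ^ n := by ring
        _ ≤ 2 * (h n * levelWidth n) := by linarith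
        _ = 4 * h n * levelWidth (n + 1) := by rw [levelWidth_eq_add n]; ring
        _ ≤ _ := by gcongr
  exact tendsto_atTop_mono hle (tendsto_pow_atTop_atTop_of_one_lt one_lt_two)

lemma fillsHalfLine (hh : IsHeightSequence h) : (skyscraperData h).FillsHalfLine := by
  simpa [RankOneData.FillsHalfLine, hh.column_eq, StackColumn.mass, StackColumn.height]
    using hh.tendsto_mass

lemma monotone_mass (hh : IsHeightSequence h) : Monotone fun n => (h n : ℝ) * levelWidth n := by
  refine monotone_nat_of_le_succ fun n => ?_
  have h4 : (4 : ℝ) * h n ≤ h (n + 1) := by exact_mod_cast hh.four_mul_le n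
  have := levelWidth_pos (n + 1)
  have h0 : (0 : ℝ) ≤ h n := by positivity
  calc (h n : ℝ) * levelWidth n = 2 * h n * levelWidth (n + 1) := by rw [levelWidth_eq_add n]; ring
    _ ≤ _ := by gcongr; linarith

end IsHeightSequence

/-- The point `x` lies on the `k`-th level of the `n`-th column, at distance `t` from its left
endpoint. -/
structure OnLevel (h : ℕ → ℕ) (n k : ℕ) (t x : ℝ) : Prop where
  lt_height : k < h n
  nonneg : 0 ≤ t
  lt_width : t < levelWidth n
  eq : x = levelStart h n k + t

namespace OnLevel

variable {h : ℕ → ℕ} {n k k' : ℕ} {t t' x y : ℝ}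

lemma left (hh : IsHeightSequence h) (H : OnLevel h n k t x) (ht : t < levelWidth (n + 1)) :
    OnLevel h (n + 1) k t x := by
  have h4 := hh.four_mul_le n
  have hk := H.lt_height
  exact ⟨by omega, H.nonneg, ht, by rw [H.eq]; simp [levelStart, hk]⟩

lemma right (hh : IsHeightSequence h) (H : OnLevel h n k t x) (ht : levelWidth (n + 1) ≤ t) :
    OnLevel h (n + 1) (k + h n) (t - levelWidth (n + 1)) x := by
  have h4 := hh.four_mul_le n
  have hk := H.lt_height
  have hw := levelWidth_eq_add n
  have := H.lt_width
  exact ⟨by omega, by linarith, by linarith, by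
    rw [H.eq]; simp [levelStart, show k + h n < 2 * h n by omega]⟩

lemma cases_succ (H : OnLevel h (n + 1) k t x) :
    OnLevel h n k t x ∨
    (∃ j, k = j + h n ∧ OnLevel h n j (t + levelWidth (n + 1)) x) ∨
    (∃ j, k = j + 2 * h n ∧ x = h n * levelWidth n + j * levelWidth (n + 1) + t) := by
  have hw := levelWidth_eq_add n
  have := H.lt_width
  have := H.nonneg
  have := levelWidth_pos (n + 1)
  by_cases h1 : k < h n
  · exact Or.inl ⟨h1, H.nonneg, by linarith, by rw [H.eq]; simp [levelStart, h1]⟩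
  by_cases h2 : k < 2 * h n
  · refine Or.inr (Or.inl ⟨k - h n, by omega, by omega, by linarith, by linarith, ?_⟩)
    rw [H.eq]; simp only [levelStart, h1, h2, if_false, if_true]; ring
  · refine Or.inr (Or.inr ⟨k - 2 * h n, by omega, ?_⟩)
    rw [H.eq]; simp only [levelStart, h1, h2, if_false]

lemma zero_le_point (H : OnLevel h n k t x) : 0 ≤ x := by
  induction n generalizing k t with
  | zero => have := H.nonneg; rw [H.eq]; simpa [levelStart]
  | succ n ih =>
    rcases H.cases_succ with H' | ⟨j, -, H'⟩ | ⟨j, -, rfl⟩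
    · exact ih H'
    · exact ih H'
    · have := levelWidth_pos n; have := levelWidth_pos (n + 1); have := H.nonneg; positivity

lemma lt_mass (hh : IsHeightSequence h) (H : OnLevel h n k t x) : x < h n * levelWidth n := by
  induction n generalizing k t with
  | zero => have := H.lt_width; rw [H.eq]; simpa [levelStart, hh.zero]
  | succ n ih =>
    have hm := hh.monotone_mass n.le_succ
    rcases H.cases_succ with H' | ⟨j, -, H'⟩ | ⟨j, hj, rfl⟩
    · exact (ih H').trans_le hm
    · exact (ih H').trans_le hm
    · have h1 : (j : ℝ) + 1 + 2 * h n ≤ h (n + 1) := by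
        have := H.lt_height; exact_mod_cast (by omega : j + 1 + 2 * h n ≤ h (n + 1))
      have := H.lt_width
      have := levelWidth_pos (n + 1)
      calc _ < (j + 1 + 2 * h n) * levelWidth (n + 1) := by
            rw [levelWidth_eq_add n]; nlinarith
        _ ≤ _ := by gcongr

/-- A point below the mass of the `n`-th column is not on a spacer added to it. -/
lemma cases_succ_of_lt (H : OnLevel h (n + 1) k t x) (hx : x < h n * levelWidth n) :
    OnLevel h n k t x ∨ ∃ j, k = j + h n ∧ OnLevel h n j (t + levelWidth (n + 1)) x := by
  rcases H.cases_succ with H' | H' | ⟨j, -, hj⟩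
  · exact Or.inl H'
  · exact Or.inr H'
  · have := H.nonneg
    have : 0 ≤ (j : ℝ) * levelWidth (n + 1) := mul_nonneg (by positivity) (levelWidth_pos _).le
    linarith

lemma unique (hh : IsHeightSequence h) (H : OnLevel h n k t x) (H' : OnLevel h n k' t' x) :
    k = k' ∧ t = t' := by
  induction n generalizing k k' t t' with
  | zero =>
    have h1 := H.lt_height
    have h2 := H'.lt_height
    have h3 := H.eq
    have h4 := H'.eq
    rw [hh.zero] at h1 h2
    simp only [levelStart, zero_add] at h3 h4
    exact ⟨by omega, by linarith⟩
  | succ n ih =>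
    have hw := levelWidth_eq_add n
    have h1 := H.lt_width
    have h2 := H'.lt_width
    have h3 := H.nonneg
    have h4 := H'.nonneg
    by_cases hx : x < h n * levelWidth n
    · rcases H.cases_succ_of_lt hx with G | ⟨j, rfl, G⟩ <;>
      rcases H'.cases_succ_of_lt hx with G' | ⟨j', rfl, G'⟩
      · exact ih G G'
      -- The offset in a level of column `n` is below `levelWidth (n + 1)` in the left subcolumn and
      -- at least that in the right one.
      · have := (ih G G').2; linarith
      · have := (ih G G').2; linarith
      · have := ih G G'; exact ⟨by omega, by linarith⟩
    · rcases H.cases_succ with G | ⟨j, -, G⟩ | ⟨j, rfl, hj⟩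
      · exact absurd (G.lt_mass hh) hx
      · exact absurd (G.lt_mass hh) hx
      rcases H'.cases_succ with G | ⟨j', -, G⟩ | ⟨j', rfl, hj'⟩
      · exact absurd (G.lt_mass hh) hx
      · exact absurd (G.lt_mass hh) hx
      have hpos := levelWidth_pos (n + 1)
      have a1 : (j : ℝ) < j' + 1 := by
        by_contra! hc
        nlinarith
      have a2 : (j' : ℝ) < j + 1 := by
        by_contra! hc
        nlinarith
      have a3 : j = j' := by
        have : j < j' + 1 := by exact_mod_cast a1
        have : j' < j + 1 := by exact_mod_cast a2
        omega
      subst a3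
      exact ⟨rfl, by linarith⟩

lemma exists_of_lt_mass (hh : IsHeightSequence h) (h0 : 0 ≤ x) (hx : x < h n * levelWidth n) :
    ∃ k t, OnLevel h n k t x := by
  induction n with
  | zero =>
    exact ⟨0, x, by simp [hh.zero], h0, by simpa [hh.zero] using hx, by simp [levelStart]⟩
  | succ n ih =>
    have h4 := hh.four_mul_le n
    by_cases hx' : x < h n * levelWidth n
    · obtain ⟨k, t, H⟩ := ih hx'
      by_cases ht : t < levelWidth (n + 1)
      · exact ⟨_, _, H.left hh ht⟩
      · exact ⟨_, _, H.right hh (not_lt.1 ht)⟩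
    · have hpos := levelWidth_pos (n + 1)
      push Not at hx'
      set z := (x - h n * levelWidth n) / levelWidth (n + 1) with hz
      have hz0 : 0 ≤ z := div_nonneg (by linarith) hpos.le
      have hxz : x = h n * levelWidth n + z * levelWidth (n + 1) := by rw [hz]; field_simp; ring
      have h1 := Nat.floor_le hz0
      have h2 := Nat.lt_floor_add_one z
      refine ⟨⌊z⌋₊ + 2 * h n, (z - ⌊z⌋₊) * levelWidth (n + 1), ?_, ?_, ?_, ?_⟩
      · have : ((⌊z⌋₊ + 2 * h n : ℕ) : ℝ) < h (n + 1) := by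
          push_cast
          refine lt_of_mul_lt_mul_right ?_ hpos.le
          rw [levelWidth_eq_add n] at hxz
          nlinarith
        exact_mod_cast this
      · exact mul_nonneg (by linarith) hpos.le
      · nlinarith
      · simp only [levelStart, show ¬ (⌊z⌋₊ + 2 * h n < h n) by omega,
          show ¬ (⌊z⌋₊ + 2 * h n < 2 * h n) by omega, if_false, Nat.add_sub_cancel]
        rw [hxz]; ring

lemma levelStart_zero (hh : IsHeightSequence h) (n : ℕ) : levelStart h n 0 = 0 := by
  induction n with
  | zero => rfl
  | succ n ih => simp [levelStart, hh.pos n, ih]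

lemma base (hh : IsHeightSequence h) (h0 : 0 ≤ x) (hx : x < levelWidth n) : OnLevel h n 0 x x :=
  ⟨hh.pos n, h0, hx, by rw [levelStart_zero hh, zero_add]⟩

end OnLevel

/-! ### The translation along the columns -/

/-- The point `y` lies straight above `x`, by `m` levels, in the `n`-th column. -/
def IsAbove (h : ℕ → ℕ) (n m : ℕ) (x y : ℝ) : Prop :=
  ∃ k t, OnLevel h n k t x ∧ OnLevel h n (k + m) t y

namespace IsAbove

variable {h : ℕ → ℕ} {n m p N : ℕ} {x y z : ℝ}

lemma succ (hh : IsHeightSequence h) (H : IsAbove h n m x y) : IsAbove h (n + 1) m x y := by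
  obtain ⟨k, t, h1, h2⟩ := H
  by_cases ht : t < levelWidth (n + 1)
  · exact ⟨k, t, h1.left hh ht, h2.left hh ht⟩
  · refine ⟨_, _, h1.right hh (not_lt.1 ht), ?_⟩
    rw [add_right_comm]
    exact h2.right hh (not_lt.1 ht)

lemma mono (hh : IsHeightSequence h) (hn : n ≤ N) (H : IsAbove h n m x y) : IsAbove h N m x y := by
  induction N, hn using Nat.le_induction with
  | base => exact H
  | succ N _ ih => exact ih.succ hh

lemma trans (hh : IsHeightSequence h) (H : IsAbove h n m x y) (H' : IsAbove h n p y z) :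
    IsAbove h n (m + p) x z := by
  obtain ⟨k, t, h1, h2⟩ := H
  obtain ⟨k', t', h3, h4⟩ := H'
  obtain ⟨rfl, rfl⟩ := h2.unique hh h3
  exact ⟨k, t, h1, by rwa [← add_assoc]⟩

lemma right_unique (hh : IsHeightSequence h) (H : IsAbove h n m x y) (H' : IsAbove h N m x z) :
    y = z := by
  obtain ⟨k, t, h1, h2⟩ := H.mono hh (le_max_left n N)
  obtain ⟨k', t', h3, h4⟩ := H'.mono hh (le_max_right n N)
  obtain ⟨rfl, rfl⟩ := h1.unique hh h3
  rw [h2.eq, h4.eq]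

lemma left_unique (hh : IsHeightSequence h) (H : IsAbove h n m x z) (H' : IsAbove h N m y z) :
    x = y := by
  obtain ⟨k, t, h1, h2⟩ := H.mono hh (le_max_left n N)
  obtain ⟨k', t', h3, h4⟩ := H'.mono hh (le_max_right n N)
  obtain ⟨hk, rfl⟩ := h2.unique hh h4
  obtain rfl : k = k' := by omega
  rw [h1.eq, h3.eq]

lemma nonneg_right (H : IsAbove h n m x y) : 0 ≤ y := by
  obtain ⟨_, _, -, H'⟩ := H
  exact H'.zero_le_point

lemma right_ne_zero (hh : IsHeightSequence h) (H : IsAbove h n (m + 1) x y) : y ≠ 0 := by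
  rintro rfl
  obtain ⟨k, t, -, h2⟩ := H
  have := (h2.unique hh (OnLevel.base hh le_rfl (levelWidth_pos n))).1
  omega

/-- A point already covered by column `n` lies below the new spacers in column `n + 1`, hence not on
the top level. -/
lemma exists_right (hh : IsHeightSequence h) (hx : 0 ≤ x) : ∃ n y, IsAbove h n 1 x y := by
  obtain ⟨n, hn⟩ := (hh.tendsto_mass.eventually_gt_atTop x).exists
  obtain ⟨k, t, H⟩ := OnLevel.exists_of_lt_mass hh hx (hn.trans_le (hh.monotone_mass n.le_succ))
  have h4 := hh.four_mul_le n
  have h0 := hh.pos n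
  have hk : k < 2 * h n := by
    rcases H.cases_succ_of_lt hn with G | ⟨j, rfl, G⟩
    · have := G.lt_height; omega
    · have := G.lt_height; omega
  exact ⟨n + 1, levelStart h (n + 1) (k + 1) + t, k, t, H, by omega, H.nonneg, H.lt_width, rfl⟩

/-- Once the width is less than `y`, the point `y` is off the bottom level `[0, levelWidth n)`. -/
lemma exists_left (hh : IsHeightSequence h) (hy : 0 < y) : ∃ n x, 0 ≤ x ∧ IsAbove h n 1 x y := by
  have hw : Tendsto levelWidth atTop (nhds 0) :=
    tendsto_pow_atTop_nhds_zero_of_lt_one (by norm_num) (by norm_num)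
  obtain ⟨n, hn, hny⟩ := ((hh.tendsto_mass.eventually_gt_atTop y).and
    (hw.eventually (gt_mem_nhds hy))).exists
  obtain ⟨k, t, H⟩ := OnLevel.exists_of_lt_mass hh hy.le hn
  have ht := H.lt_width
  have hlt := H.lt_height
  rcases k with _ | k
  · have := H.eq
    rw [OnLevel.levelStart_zero hh] at this
    linarith
  · have H' : OnLevel h n k t (levelStart h n k + t) := ⟨by omega, H.nonneg, ht, rfl⟩
    exact ⟨n, _, H'.zero_le_point, k, t, H', H⟩

lemma mapsTo (hh : IsHeightSequence h) (H : IsAbove h n 1 x y) :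
    ((skyscraperData h).column n).MapsTo x y := by
  obtain ⟨k, t, h1, h2⟩ := H
  rw [hh.column_eq]
  have e1 := h1.eq
  have e2 := h2.eq
  have := h1.nonneg
  have := h1.lt_width
  refine ⟨k, by simpa using h2.lt_height, ?_, ?_⟩
  · simp only [List.getElem_map, List.getElem_range, Set.mem_Ico]
    constructor <;> linarith
  · simp only [List.getElem_map, List.getElem_range]
    linarith

/-- The times at which a point of the base of a column can return to the base are close to the
heights of the later columns. -/
lemma exists_height_near (hh : IsHeightSequence h) (H : IsAbove h n m x y) (hm : 0 < m)
    (hx : x < levelWidth (N + 1)) (hy : y < levelWidth (N + 1)) :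
    ∃ k, N ≤ k ∧ h (k + 1) ≤ m + 2 * h k ∧ m ≤ h (k + 1) + 2 * h k := by
  have hone : ∀ M, (1 : ℝ) ≤ h M * levelWidth M := fun M => by
    simpa [hh.zero, levelWidth_zero] using hh.monotone_mass M.zero_le
  have hle1 : levelWidth (N + 1) ≤ 1 := levelWidth_zero ▸ antitone_levelWidth (N + 1).zero_le
  have hlt : ∀ {M k t u}, OnLevel h (M + 1) k t u → u < 1 → k < 2 * h M := by
    intro M k t u G hu
    rcases G.cases_succ_of_lt (hu.trans_le (hone M)) with F | ⟨j, rfl, F⟩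
    · have := F.lt_height; omega
    · have := F.lt_height; omega
  -- Two points in the same subcolumn are compared one column earlier. When they separate in column
  -- `M + 2`, the gap is `h (M + 1)` up to the difference of their levels in column `M + 1`, both
  -- below `2 * h M` by `hlt`. In column `N + 1` both points are on the base, so there is no gap.
  have key : ∀ M, N ≤ M → ∀ p q t u, OnLevel h (M + 1) p t x → OnLevel h (M + 1) q u y → p < q →
      ∃ k, N ≤ k ∧ h (k + 1) ≤ q - p + 2 * h k ∧ q - p ≤ h (k + 1) + 2 * h k := by
    intro M hM
    induction M, hM using Nat.le_induction with
    | base =>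
      intro p q t u G G' hpq
      have := (G'.unique hh (OnLevel.base hh G'.zero_le_point hy)).1
      omega
    | succ M hM ih =>
      intro p q t u G G' hpq
      rcases G.cases_succ_of_lt (by linarith [hone (M + 1)]) with F | ⟨j, rfl, F⟩ <;>
      rcases G'.cases_succ_of_lt (by linarith [hone (M + 1)]) with F' | ⟨j', rfl, F'⟩
      · exact ih p q _ _ F F' hpq
      · have := hlt F (by linarith)
        have := hlt F' (by linarith)
        exact ⟨M, hM, by omega, by omega⟩
      · have := F'.lt_height
        omega
      · simpa [Nat.add_sub_add_right] using ih j j' _ _ F F' (by omega)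
  obtain ⟨k, t, h1, h2⟩ := H.mono hh ((le_max_left n (N + 1)).trans (Nat.le_succ _))
  obtain ⟨k', hk'⟩ := key _ ((Nat.le_succ N).trans (le_max_right n (N + 1))) _ _ _ _ h1 h2 (by omega)
  rw [Nat.add_sub_cancel_left] at hk'
  exact ⟨k', hk'⟩

end IsAbove

/-! ### Completing an injection to a bijection -/

section completion

variable {α : Type*}

open Classical in
/-- The map `f`, replaced by the identity on the orbit of `a`. -/
noncomputable def fixOrbit (f : α → α) (a : α) (x : α) : α :=
  if x ∈ Set.range (fun n => f^[n] a) then x else f x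

variable {f : α → α} {a : α}

lemma fixOrbit_of_notMem {x : α} (hx : x ∉ Set.range (fun n => f^[n] a)) :
    fixOrbit f a x = f x := if_neg hx

lemma fixOrbit_of_mem {x : α} (hx : x ∈ Set.range (fun n => f^[n] a)) :
    fixOrbit f a x = x := if_pos hx

lemma apply_notMem_orbit (hf : f.Injective) (ha : ∀ x, f x ≠ a) {x : α}
    (hx : x ∉ Set.range (fun n => f^[n] a)) : f x ∉ Set.range (fun n => f^[n] a) := by
  rintro ⟨n, hn⟩
  rcases n with _ | n
  · exact ha x hn.symm
  · simp only [Function.iterate_succ_apply'] at hn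
    exact hx ⟨n, hf hn⟩

/-- As `f` misses only `a`, it maps the complement of the orbit of `a` bijectively to itself. -/
lemma bijective_fixOrbit (hf : f.Injective) (ha : ∀ x, f x ≠ a)
    (hsurj : ∀ y, y ≠ a → ∃ x, f x = y) : (fixOrbit f a).Bijective := by
  constructor
  · intro x y hxy
    by_cases hx : x ∈ Set.range (fun n => f^[n] a) <;>
    by_cases hy : y ∈ Set.range (fun n => f^[n] a)
    · rwa [fixOrbit_of_mem hx, fixOrbit_of_mem hy] at hxy
    · rw [fixOrbit_of_mem hx, fixOrbit_of_notMem hy] at hxy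
      exact absurd (hxy ▸ hx) (apply_notMem_orbit hf ha hy)
    · rw [fixOrbit_of_notMem hx, fixOrbit_of_mem hy] at hxy
      exact absurd (hxy ▸ hy) (apply_notMem_orbit hf ha hx)
    · rw [fixOrbit_of_notMem hx, fixOrbit_of_notMem hy] at hxy
      exact hf hxy
  · intro y
    by_cases hy : y ∈ Set.range (fun n => f^[n] a)
    · exact ⟨y, fixOrbit_of_mem hy⟩
    · obtain ⟨x, rfl⟩ := hsurj y fun h => hy ⟨0, h.symm⟩
      refine ⟨x, fixOrbit_of_notMem fun hx => hy ?_⟩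
      obtain ⟨n, rfl⟩ := hx
      exact ⟨n + 1, Function.iterate_succ_apply' f n a⟩

lemma measurable_fixOrbit [MeasurableSpace α] [MeasurableSingletonClass α] (hf : Measurable f) :
    Measurable (fixOrbit f a) :=
  Measurable.ite (Set.countable_range _).measurableSet measurable_id hf

end completion

/-! ### The skyscraper transformation -/

instance sigmaFinite_halfLineMeasure : SigmaFinite halfLineMeasure := by
  refine SigmaFinite.of_map _ measurable_subtype_coe.aemeasurable ?_
  rw [halfLineMeasure, map_comap_subtype_coe measurableSet_Ici]
  infer_instance

lemma halfLineMeasure_apply (A : Set HalfLine) :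
    halfLineMeasure A = volume (((↑) : HalfLine → ℝ) '' A) :=
  (MeasurableEmbedding.subtype_coe measurableSet_Ici).comap_apply _ _

lemma halfLineMeasure_eq_zero_of_countable {A : Set HalfLine} (hA : A.Countable) :
    halfLineMeasure A = 0 := by
  rw [halfLineMeasure_apply]
  exact (hA.image _).measure_zero _

lemma halfLineMeasure_setOf_lt_pos {c : ℝ} (hc : 0 < c) :
    0 < halfLineMeasure {x : HalfLine | (x : ℝ) < c} := by
  have : ((↑) : HalfLine → ℝ) '' {x : HalfLine | (x : ℝ) < c} = Set.Ico 0 c := by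
    ext x
    simp [and_comm]
  rw [halfLineMeasure_apply, this]
  simpa using hc

/-- There is a skyscraper transformation with given column heights that, off a countable set with
invariant complement, is the translation along the columns. -/
lemma exists_skyscraperTransformation {h : ℕ → ℕ} (hh : IsHeightSequence h) :
    ∃ (S : HalfLine ≃ᵐ HalfLine) (O : Set HalfLine), IsSkyscraperTransformation S ∧ O.Countable ∧
      ∀ x ∉ O, S x ∉ O ∧ ∃ n, IsAbove h n 1 (x : ℝ) (S x : ℝ) := by
  have hex : ∀ x : HalfLine, ∃ y : HalfLine, ∃ n, IsAbove h n 1 (x : ℝ) (y : ℝ) := fun x => by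
    obtain ⟨n, y, H⟩ := IsAbove.exists_right hh x.2
    exact ⟨⟨y, H.nonneg_right⟩, n, H⟩
  choose f g hfg using hex
  have hinj : f.Injective := fun x y hxy =>
    Subtype.ext ((hfg x).left_unique hh (hxy ▸ hfg y))
  set a : HalfLine := ⟨0, Set.self_mem_Ici⟩ with ha_def
  have ha : ∀ x, f x ≠ a := fun x hx => (hfg x).right_ne_zero hh (congrArg Subtype.val hx)
  have hsurj : ∀ y, y ≠ a → ∃ x, f x = y := fun y hy => by
    have hy0 : (0 : ℝ) < y := lt_of_le_of_ne y.2 fun h => hy (Subtype.ext h.symm)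
    obtain ⟨n, x, hx, H⟩ := IsAbove.exists_left hh hy0
    exact ⟨⟨x, hx⟩, Subtype.ext ((hfg ⟨x, hx⟩).right_unique hh H)⟩
  have hmeas : Measurable f := by
    refine Measurable.subtype_mk (f := fun x => (f x : ℝ)) (h := fun x => (f x).2) fun s hs => ?_
    -- On each of the countably many levels that are not on top of their column, `f` is a
    -- translation.
    have hpre : (fun x => (f x : ℝ)) ⁻¹' s = ⋃ n, ⋃ k, {x : HalfLine |
        k + 1 < h n ∧ levelStart h n k ≤ x ∧ (x : ℝ) < levelStart h n k + levelWidth n ∧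
          levelStart h n (k + 1) + (x - levelStart h n k) ∈ s} := by
      ext x
      simp only [Set.mem_preimage, Set.mem_iUnion, Set.mem_ofPred_eq]
      constructor
      · intro hx
        obtain ⟨k, t, h1, h2⟩ := hfg x
        have := h1.nonneg
        have := h1.lt_width
        have := h1.eq
        refine ⟨g x, k, h2.lt_height, by linarith, by linarith, ?_⟩
        rwa [show (x : ℝ) - levelStart h (g x) k = t by linarith, ← h2.eq]
      · rintro ⟨n, k, h1, h2, h3, h4⟩
        have H : IsAbove h n 1 (x : ℝ) (levelStart h n (k + 1) + (x - levelStart h n k)) :=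
          ⟨k, x - levelStart h n k, ⟨by omega, by linarith, by linarith, by ring⟩,
            ⟨h1, by linarith, by linarith, rfl⟩⟩
        rwa [(hfg x).right_unique hh H]
    rw [hpre]
    refine MeasurableSet.iUnion fun n => MeasurableSet.iUnion fun k => ?_
    have hc : Measurable fun x : HalfLine => (x : ℝ) := measurable_subtype_coe
    exact (MeasurableSet.const _).inter ((measurableSet_le measurable_const hc).inter
      ((measurableSet_lt hc measurable_const).inter
        (((hc.sub_const _).const_add _) hs)))
  set O : Set HalfLine := Set.range (fun n => f^[n] a) with hO
  have hOc : O.Countable := Set.countable_range _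
  have hbij := bijective_fixOrbit hinj ha hsurj
  have hm : Measurable (fixOrbit f a) := measurable_fixOrbit hmeas
  have : StandardBorelSpace HalfLine := measurableSet_Ici.standardBorel
  -- The Lusin–Souslin theorem gives measurability of the inverse.
  have hemb : MeasurableEmbedding (fixOrbit f a) := hm.measurableEmbedding hbij.1
  let S : HalfLine ≃ᵐ HalfLine :=
    { Equiv.ofBijective _ hbij with
      measurable_toFun := hm
      measurable_invFun := fun A hA => by
        rw [← Equiv.image_eq_preimage_symm]
        exact hemb.measurableSet_image.2 hA }
  have hS : ∀ x ∉ O, S x = f x := fun x hx => fixOrbit_of_notMem hx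
  refine ⟨S, O, ⟨skyscraperData h, isSkyscraper_skyscraperData h, hh.fillsHalfLine, ?_⟩, hOc,
    fun x hx => ?_⟩
  · filter_upwards [compl_mem_ae_iff.2 (halfLineMeasure_eq_zero_of_countable hOc)] with x hx
    filter_upwards [eventually_ge_atTop (g x)] with n hn
    rw [hS x hx]
    exact ((hfg x).mono hh hn).mapsTo hh
  · rw [hS x hx]
    exact ⟨apply_notMem_orbit hinj ha hx, g x, hfg x⟩

/-! ### Products -/

lemma prodCongr_zpow_apply {α β : Type*} (e : Equiv.Perm α) (f : Equiv.Perm β) (n : ℤ) (x : α × β) :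
    ((Equiv.prodCongr e f : Equiv.Perm (α × β)) ^ n) x = ((e ^ n) x.1, (f ^ n) x.2) := by
  let φ : Equiv.Perm α × Equiv.Perm β →* Equiv.Perm (α × β) :=
    { toFun := fun p => Equiv.prodCongr p.1 p.2
      map_one' := rfl
      map_mul' := fun _ _ => rfl }
  change (φ (e, f) ^ n) x = _
  rw [← map_zpow]
  rfl

lemma MeasurableEquiv.toEquiv_pow_apply {α : Type*} [MeasurableSpace α] (R : α ≃ᵐ α) (m : ℕ)
    (y : α) : ((R.toEquiv : Equiv.Perm α) ^ m) y = R^[m] y := by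
  rw [Equiv.Perm.coe_pow]
  rfl

lemma MeasurableEquiv.iterate_toEquiv_zpow_neg_apply {α : Type*} [MeasurableSpace α] (R : α ≃ᵐ α)
    (m : ℕ) (y : α) : R^[m] (((R.toEquiv : Equiv.Perm α) ^ (-(m : ℤ))) y) = y := by
  rw [← R.toEquiv_pow_apply, ← zpow_natCast, ← Equiv.Perm.mul_apply, ← zpow_add]
  simp

theorem mainTheorem2 {X : ℕ → Type*} [∀ i, MeasurableSpace (X i)]
    (μ : ∀ i, Measure (X i)) [∀ i, SigmaFinite (μ i)]
    (T : ∀ i, X i ≃ᵐ X i)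
    (hT : ∀ i, IsNonsingular (T i) (μ i))
    (hfin : ∀ i, ¬ HasFiniteInvariantMeasure (T i) (μ i)) :
    ∃ S : HalfLine ≃ᵐ HalfLine, IsSkyscraperTransformation S ∧
      ∀ i, ¬ IsConservative ((T i).prodCongr S) ((μ i).prod halfLineMeasure) := by
  obtain ⟨h, h0, h4, hW⟩ := exists_heights_avoiding_of_not_hasFiniteInvariantMeasure μ T hT hfin
  have hh : IsHeightSequence h := ⟨h0, h4⟩
  obtain ⟨S, O, hS, hO, hSO⟩ := exists_skyscraperTransformation hh
  refine ⟨S, hS, fun i hcons => ?_⟩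
  obtain ⟨W, hWm, hW0, hWr⟩ := hW i
  -- The base of column `i + 1` returns only near heights `h (k + 1)` with `k ≥ i`, exactly those
  -- that `W` avoids.
  set B : Set HalfLine := {x : HalfLine | (x : ℝ) < levelWidth (i + 1)} \ O with hB
  have hBm : MeasurableSet B :=
    (measurableSet_lt measurable_subtype_coe measurable_const).diff hO.measurableSet
  have hB0 : halfLineMeasure B ≠ 0 := by
    rw [hB, measure_sdiff_null (halfLineMeasure_eq_zero_of_countable hO)]
    exact (halfLineMeasure_setOf_lt_pos (levelWidth_pos _)).ne'
  have hiter : ∀ (m : ℕ) (x : HalfLine), x ∉ O → S^[m + 1] x ∉ O ∧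
      ∃ n, IsAbove h n (m + 1) (x : ℝ) (S^[m + 1] x : HalfLine) := by
    intro m x hx
    induction m with
    | zero => simpa using hSO x hx
    | succ m ih =>
      obtain ⟨h1, n, h2⟩ := ih
      obtain ⟨h3, n', h4⟩ := hSO _ h1
      rw [Function.iterate_succ_apply']
      exact ⟨h3, max n n', (h2.mono hh (le_max_left _ _)).trans hh (h4.mono hh (le_max_right _ _))⟩
  have hret : ∀ m : ℕ, 0 < m → ∀ (w : X i) (b : HalfLine), w ∈ W → b ∈ B → (T i)^[m] w ∈ W →
      S^[m] b ∈ B → False := by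
    intro m hm w b hw hb hw' hb'
    obtain ⟨m, rfl⟩ := Nat.exists_eq_succ_of_ne_zero hm.ne'
    obtain ⟨-, n, H⟩ := hiter m b hb.2
    obtain ⟨k, hk1, hk2, hk3⟩ := H.exists_height_near hh hm hb.1 hb'.1
    exact hWr w hw k hk1 _ hk2 hk3 hw'
  obtain ⟨n, hn, hn0⟩ := hcons (W ×ˢ B) (hWm.prod hBm) (by
    rw [Measure.prod_prod]; exact ENNReal.mul_pos hW0 hB0)
  obtain ⟨_, ⟨⟨w, b⟩, ⟨hw, hb⟩, rfl⟩, hn2⟩ := nonempty_of_measure_ne_zero hn.ne'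
  have hprod : (((T i).prodCongr S).toEquiv : Equiv.Perm (X i × HalfLine)) =
    Equiv.prodCongr (T i).toEquiv S.toEquiv := rfl
  rw [hprod, prodCongr_zpow_apply] at hn2
  obtain ⟨hw', hb'⟩ := hn2
  simp only at hw hb hw' hb'
  rcases Int.eq_nat_or_neg n with ⟨m, rfl | rfl⟩
  · rw [zpow_natCast, MeasurableEquiv.toEquiv_pow_apply] at hw' hb'
    exact hret m (by omega) w b hw hb hw' hb'
  -- For a negative time, the image point returns to `(w, b)` after the positive time `m`.
  · refine hret m (by omega) _ _ hw' hb' ?_ ?_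
    · rwa [MeasurableEquiv.iterate_toEquiv_zpow_neg_apply]
    · rwa [MeasurableEquiv.iterate_toEquiv_zpow_neg_apply]
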